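/- There are absolute constants $C, c' > 0$ such that the following holds. Let $d \ge 1$ and $n$ be integers and let $k$ be a real number with $2 \le k \le n$ and $k \ge C(d+1)\log n$. Let $X_1, \dots, X_n$ be independent (not necessarily identically distributed) random vectors in $\mathbb{R}^d$ with laws $P_1,\dots,P_n$, whose mixture $\overline P = \frac1n\sum_{i=1}^n P_i$ is radially symmetric and unimodal about the origin, i.e. has a Lebesgue density $x \mapsto g(\|x\|_2)$ with $g$ nonincreasing on $[0,\infty)$. Write $B(x,r)$ for the closed Euclidean ball with centre $x$ and radius $r$, and put $$ r_{2k} = \inf\Big\{ r \ge 0 : \sup_{x \in \mathbb{R}^d} \overline P(B(x,r)) \ge \tfrac{2k}{n} \Big\} \quad (\inf\emptyset = +\infty), \qquad \widehat r_k = \inf\Big\{ r \ge 0 : \sup_{x\in\mathbb{R}^d} \tfrac1n \#\{i : X_i \in B(x,r)\} \ge \tfrac{k}{n} \Big\}, $$ and let the $k$-shorth estimator be $$ \widehat\mu_{S,k} \in \arg\max_{x \in \mathbb{R}^d} \#\{ i : X_i \in B(x, \widehat r_k) \}, $$ the centre of a smallest ball containing at least $k$ of the points, with ties broken arbitrarily.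 Then, with probability at least $1 - 2\exp(-c' d \log n)$, whatever the rule for breaking ties, $$ \|\widehat\mu_{S,k}\|_2 \le 4\, r_{2k} \left(\frac{2n}{k}\right)^{1/d}. $$ -/

import Mathlib

open MeasureTheory ProbabilityTheory
open scoped ENNReal

noncomputable section

/-- Indicator function `f_{x,r}` of the closed Euclidean ball of radius `r` centred at `x`. -/
def ballInd {d : ℕ} (x : EuclideanSpace ℝ (Fin d)) (r : ℝ) : EuclideanSpace ℝ (Fin d) → ℝ :=
  (Metric.closedBall x r).indicator (fun _ => 1)

/-- Empirical average `R_n(f) = (1/n) ∑ f(z_i)` of `f` over the data `z_1, …, z_n`. -/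
def empRisk {d n : ℕ} (z : Fin n → EuclideanSpace ℝ (Fin d))
    (f : EuclideanSpace ℝ (Fin d) → ℝ) : ℝ :=
  (1 / (n : ℝ)) * ∑ i, f (z i)

/-- Population average `R(f) = (1/n) ∑ E f(X_i)`. -/
def popRisk {d n : ℕ} {Ω : Type*} [MeasurableSpace Ω] (P : Measure Ω)
    (X : Fin n → Ω → EuclideanSpace ℝ (Fin d)) (f : EuclideanSpace ℝ (Fin d) → ℝ) : ℝ :=
  (1 / (n : ℝ)) * ∑ i, ∫ ω, f (X i ω) ∂P

/-- The mixture `(1/n) ∑ P_i` of the laws of `X_1, …, X_n`. -/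
def mixtureLaw {d n : ℕ} {Ω : Type*} [MeasurableSpace Ω] (P : Measure Ω)
    (X : Fin n → Ω → EuclideanSpace ℝ (Fin d)) : Measure (EuclideanSpace ℝ (Fin d)) :=
  (n : ℝ≥0∞)⁻¹ • ∑ i, P.map (X i)

/-- A measure on `ℝ^d` that is radially symmetric and unimodal about the origin: it has a Lebesgue
density of the form `x ↦ g ‖x‖` with `g` nonincreasing on `[0, ∞)`. -/
def IsRadialUnimodal {d : ℕ} (ν : Measure (EuclideanSpace ℝ (Fin d))) : Prop :=
  ∃ g : ℝ → ℝ≥0∞, AntitoneOn g (Set.Ici 0) ∧ ν = volume.withDensity (fun x => g ‖x‖)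

/-- `r_k = inf {r ≥ 0 : sup_x R(f_{x,r}) ≥ k/n}`, equal to `∞` if there is no such `r`. -/
def popRadius {d n : ℕ} {Ω : Type*} [MeasurableSpace Ω] (P : Measure Ω)
    (X : Fin n → Ω → EuclideanSpace ℝ (Fin d)) (k : ℝ) : ℝ≥0∞ :=
  ⨅ (r : ℝ) (_ : 0 ≤ r ∧ k / n ≤ ⨆ x : EuclideanSpace ℝ (Fin d), popRisk P X (ballInd x r)),
    ENNReal.ofReal r

/-- `r̂_k = inf {r ≥ 0 : sup_x R_n(f_{x,r}) ≥ k/n}`; there is such an `r` whenever `k ≤ n`. -/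
def empRadius {d n : ℕ} (z : Fin n → EuclideanSpace ℝ (Fin d)) (k : ℝ) : ℝ :=
  sInf {r : ℝ | 0 ≤ r ∧ k / n ≤ ⨆ x : EuclideanSpace ℝ (Fin d), empRisk z (ballInd x r)}

/-- `m` is a value of the `r`-modal interval estimator: `m ∈ argmax_x R_n(f_{x,r})`. -/
def IsModalCentre {d n : ℕ} (z : Fin n → EuclideanSpace ℝ (Fin d)) (r : ℝ)
    (m : EuclideanSpace ℝ (Fin d)) : Prop :=
  ∀ x : EuclideanSpace ℝ (Fin d), empRisk z (ballInd x r) ≤ empRisk z (ballInd m r)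

/-- `m` is a value of the `k`-shorth estimator: a centre of a smallest ball containing at least
`k` of the data points, i.e. a value of the modal interval estimator with radius `r̂_k`. -/
def IsShorth {d n : ℕ} (z : Fin n → EuclideanSpace ℝ (Fin d)) (k : ℝ)
    (m : EuclideanSpace ℝ (Fin d)) : Prop :=
  IsModalCentre z (empRadius z k) m

end

/-! Write `r` for the population radius at level `2k`. The ball of radius `r` about the origin has
expected count at least `2k` (Anderson), so with high probability it holds more than `k` points, and
the smallest ball with at least `k` points then has radius at most `r`. A ball of radius `r` whose
centre violates the bound has expected count at most `k/6`, because a decreasing radial density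
spreads at least `6n/k` times its mass over the ball below it about the origin. It remains to
exclude all such centres at once.

Helly's theorem makes this a finite problem (`IsShorth.exists_eq_chebyshevCenter`): the shorth is
the Chebyshev centre of some `d + 1` data points. For a fixed such set, the centre is independent of
the other points, so conditionally on a far centre Chernoff leaves probability at most `exp (-k/5)`
that `k/2` of them fall in the ball (`measureReal_chebyshevCenter_far_le`). The `d + 1` chosen
points add at most `k/2`. A union bound over `n.choose (d + 1)` sets costs `(d + 1) log n` in the
exponent, which the lower bound on `k` absorbs. -/

lemma dist_midpoint_sq {E : Type*} [NormedAddCommGroup E] [InnerProductSpace ℝ E] (a x y : E) :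
    dist a (midpoint ℝ x y) ^ 2 = (dist a x ^ 2 + dist a y ^ 2) / 2 - dist x y ^ 2 / 4 := by
  have h := parallelogram_law_with_norm ℝ (a - x) (a - y)
  have h1 : a - x + (a - y) = (2 : ℝ) • (a - midpoint ℝ x y) := by
    rw [midpoint_eq_smul_add, smul_sub, smul_smul]
    norm_num
    rw [two_smul]
    abel
  have h2 : a - x - (a - y) = y - x := by abel
  rw [h1, h2, norm_smul, Real.norm_of_nonneg zero_le_two] at h
  rw [dist_eq_norm, dist_eq_norm, dist_eq_norm, dist_comm x y, dist_eq_norm]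
  linarith

/-! ### Smallest enclosing balls and Helly's theorem -/

section Chebyshev

variable {ι E : Type*} [Fintype ι] [NormedAddCommGroup E]

/-- The radius of the smallest closed ball that contains a finite family of points. -/
noncomputable def chebyshevRadius (p : ι → E) : ℝ :=
  Metric.infDist p (Set.range (Function.const ι : E → ι → E))

lemma chebyshevRadius_nonneg (p : ι → E) : 0 ≤ chebyshevRadius p := Metric.infDist_nonneg

lemma chebyshevRadius_le_dist (p : ι → E) (x : E) :
    chebyshevRadius p ≤ dist p (Function.const ι x) :=
  Metric.infDist_le_dist_of_mem ⟨x, rfl⟩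

lemma chebyshevRadius_le {p : ι → E} {x : E} {r : ℝ} (hr : 0 ≤ r) (h : ∀ i, dist (p i) x ≤ r) :
    chebyshevRadius p ≤ r :=
  (chebyshevRadius_le_dist p x).trans ((dist_pi_le_iff hr).2 h)

variable [InnerProductSpace ℝ E] [FiniteDimensional ℝ E]

/-- In the sup metric on `ι → E`, the distance to a constant family is the covering radius from that
point; the constant families form a closed set in a proper space, so a nearest one exists. -/
lemma exists_chebyshevCenter (p : ι → E) :
    ∃ c : E, dist p (Function.const ι c) = chebyshevRadius p := by
  have hcl : IsClosed (Set.range (Function.const ι : E → ι → E)) := by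
    have : Set.range (Function.const ι : E → ι → E) = ⋂ i, ⋂ j, {f | f i = f j} := by
      ext f
      simp only [Set.mem_range, Set.mem_iInter, Set.mem_ofPred_eq]
      refine ⟨fun ⟨x, hx⟩ i j => by simp [← hx], fun h => ?_⟩
      rcases isEmpty_or_nonempty ι with hι | ⟨⟨i⟩⟩
      · exact ⟨0, Subsingleton.elim _ _⟩
      · exact ⟨f i, funext fun j => h i j⟩
    rw [this]
    exact isClosed_iInter fun i => isClosed_iInter fun j =>
      isClosed_eq (continuous_apply i) (continuous_apply j)
  have : ProperSpace E := FiniteDimensional.proper_real E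
  obtain ⟨_, ⟨c, rfl⟩, hc⟩ := hcl.exists_infDist_eq_dist (Set.range_nonempty _) p
  exact ⟨c, hc.symm⟩

/-- The centre of the smallest closed ball that contains a finite family of points. -/
noncomputable def chebyshevCenter (p : ι → E) : E := (exists_chebyshevCenter p).choose

lemma dist_chebyshevCenter (p : ι → E) :
    dist p (Function.const ι (chebyshevCenter p)) = chebyshevRadius p :=
  (exists_chebyshevCenter p).choose_spec

lemma dist_chebyshevCenter_le (p : ι → E) (i : ι) :
    dist (p i) (chebyshevCenter p) ≤ chebyshevRadius p :=
  (dist_le_pi_dist p (Function.const ι (chebyshevCenter p)) i).trans_eq (dist_chebyshevCenter p)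

/-- Strong convexity of the squared covering radius at the Chebyshev centre. -/
lemma dist_sq_chebyshevCenter_le [Nonempty ι] (p : ι → E) (x : E) :
    dist x (chebyshevCenter p) ^ 2 ≤
      2 * (dist p (Function.const ι x) ^ 2 - chebyshevRadius p ^ 2) := by
  set c := chebyshevCenter p
  set M := (dist p (Function.const ι x) ^ 2 + chebyshevRadius p ^ 2) / 2 - dist x c ^ 2 / 4 with hM
  -- `√M` bounds the covering radius from the midpoint, which cannot beat the optimal one.
  have key : ∀ i, dist (p i) (midpoint ℝ x c) ^ 2 ≤ M := fun i => by
    rw [dist_midpoint_sq, hM]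
    have h1 : dist (p i) x ≤ dist p (Function.const ι x) := dist_le_pi_dist p (Function.const ι x) i
    have h2 := dist_chebyshevCenter_le p i
    gcongr
  have hM0 : 0 ≤ M := (sq_nonneg _).trans (key (Classical.arbitrary ι))
  have hr : chebyshevRadius p ≤ √M :=
    chebyshevRadius_le (Real.sqrt_nonneg M) fun i => Real.le_sqrt_of_sq_le (key i)
  have := (Real.le_sqrt (chebyshevRadius_nonneg p) hM0).1 hr
  linarith

lemma eq_chebyshevCenter [Nonempty ι] {p : ι → E} {x : E}
    (h : ∀ i, dist (p i) x ≤ chebyshevRadius p) : x = chebyshevCenter p := by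
  have h1 : dist p (Function.const ι x) ≤ chebyshevRadius p :=
    (dist_pi_le_iff (chebyshevRadius_nonneg p)).2 h
  have h2 := dist_sq_chebyshevCenter_le p x
  have h3 : dist p (Function.const ι x) ^ 2 ≤ chebyshevRadius p ^ 2 := by gcongr
  exact dist_eq_zero.1 (pow_eq_zero_iff two_ne_zero |>.1
    (le_antisymm (by linarith) (sq_nonneg _)))

/-- Needed for measurability of the random centre. The centre of `q` covers `p` within an excess of
`2 * dist q p`, and strong convexity turns near-optimality into closeness. -/
lemma continuous_chebyshevCenter [Nonempty ι] :
    Continuous (chebyshevCenter : (ι → E) → E) := by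
  rw [continuous_iff_continuousAt]
  intro p
  have hb : ∀ q : ι → E, dist (chebyshevCenter q) (chebyshevCenter p) ≤
      √(2 * ((chebyshevRadius p + 2 * dist q p) ^ 2 - chebyshevRadius p ^ 2)) := fun q => by
    refine Real.le_sqrt_of_sq_le ((dist_sq_chebyshevCenter_le p _).trans ?_)
    have h1 := dist_triangle p q (Function.const ι (chebyshevCenter q))
    rw [dist_chebyshevCenter q, dist_comm] at h1
    have h2 := (chebyshevRadius_le_dist q (chebyshevCenter p)).trans (dist_triangle q p _)
    rw [dist_chebyshevCenter p] at h2
    rw [dist_comm p q] at h1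
    have h3 : dist p (Function.const ι (chebyshevCenter q)) ≤
        chebyshevRadius p + 2 * dist q p := by
      rw [dist_comm p]; linarith
    gcongr
  rw [ContinuousAt, tendsto_iff_dist_tendsto_zero]
  refine squeeze_zero (fun _ => dist_nonneg) hb ?_
  have hc : Continuous fun q : ι → E =>
      √(2 * ((chebyshevRadius p + 2 * dist q p) ^ 2 - chebyshevRadius p ^ 2)) := by fun_prop
  simpa using hc.tendsto p

/-- By Helly's theorem, the smallest ball around a finite set of points of a `d`-dimensional space
is the smallest ball around some `d + 1` of them. -/
lemma exists_subset_chebyshevCenter_eq {κ : Type*} (z : κ → E) (T : Finset κ)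
    (hT : Module.finrank ℝ E + 1 ≤ T.card) :
    ∃ S ⊆ T, S.card = Module.finrank ℝ E + 1 ∧
      chebyshevCenter (fun i : T => z i) = chebyshevCenter (fun i : S => z i) := by
  obtain ⟨S, hS, hmax⟩ := Finset.exists_max_image (T.powersetCard (Module.finrank ℝ E + 1))
    (fun S => chebyshevRadius (fun i : S => z i)) (Finset.powersetCard_nonempty.2 hT)
  rw [Finset.mem_powersetCard] at hS
  refine ⟨S, hS.1, hS.2, ?_⟩
  have : Nonempty S := (Finset.card_pos.1 (by omega)).to_subtype
  -- Any `d + 1` of these balls share the Chebyshev centre of their own centres, as `S` has the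
  -- largest radius.
  obtain ⟨x, hx⟩ := Convex.helly_theorem (𝕜 := ℝ) hT
    (F := fun i => Metric.closedBall (z i) (chebyshevRadius (fun i : S => z i)))
    (fun i _ => convex_closedBall _ _) (fun I hI hcard => by
      refine ⟨chebyshevCenter (fun i : I => z i), Set.mem_iInter₂.2 fun i hi => ?_⟩
      rw [Metric.mem_closedBall, dist_comm]
      exact (dist_chebyshevCenter_le (fun i : I => z i) ⟨i, hi⟩).trans
        (hmax I (Finset.mem_powersetCard.2 ⟨hI, hcard⟩)))
  have hrad : chebyshevRadius (fun i : T => z i) ≤ chebyshevRadius (fun i : S => z i) :=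
    chebyshevRadius_le (chebyshevRadius_nonneg _) (x := x) fun i => by
      rw [dist_comm]; exact Set.mem_iInter₂.1 hx i i.2
  -- The centre of `T` covers `S` within the optimal radius of `S`; uniqueness identifies the two
  -- centres.
  exact eq_chebyshevCenter fun i =>
    (dist_chebyshevCenter_le (fun i : T => z i) ⟨i, hS.1 i.2⟩).trans hrad

end Chebyshev

/-! ### Deterministic structure of the shorth -/

section Shorth

variable {d n : ℕ}

/-- The indices of the data points that lie in a closed ball. -/
noncomputable def ballIndices (z : Fin n → EuclideanSpace ℝ (Fin d)) (x : EuclideanSpace ℝ (Fin d)) (r : ℝ) :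
    Finset (Fin n) :=
  Finset.univ.filter fun i => dist (z i) x ≤ r

lemma ballInd_apply (x y : EuclideanSpace ℝ (Fin d)) (r : ℝ) :
    ballInd x r y = if dist y x ≤ r then 1 else 0 := by
  by_cases h : dist y x ≤ r <;> simp [ballInd, h]

lemma sum_ballInd (z : Fin n → EuclideanSpace ℝ (Fin d)) (x : EuclideanSpace ℝ (Fin d)) (r : ℝ)
    (S : Finset (Fin n)) :
    ∑ i ∈ S, ballInd x r (z i) = ((S ∩ ballIndices z x r).card : ℝ) := by
  simp only [ballInd_apply, ballIndices]
  rw [Finset.sum_boole]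
  congr 2
  ext i
  simp

lemma empRisk_ballInd (z : Fin n → EuclideanSpace ℝ (Fin d)) (x : EuclideanSpace ℝ (Fin d))
    (r : ℝ) : empRisk z (ballInd x r) = (ballIndices z x r).card / n := by
  rw [empRisk, sum_ballInd, Finset.univ_inter]
  ring

lemma finite_range_empRisk (z : Fin n → EuclideanSpace ℝ (Fin d)) (r : ℝ) :
    (Set.range fun x => empRisk z (ballInd x r)).Finite := by
  refine ((Set.finite_Iic n).image fun j : ℕ => (j : ℝ) / n).subset ?_
  rintro _ ⟨x, rfl⟩
  exact ⟨_, by simpa using Finset.card_le_univ (ballIndices z x r), (empRisk_ballInd z x r).symm⟩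

lemma le_iSup_empRisk_iff (hn : 0 < n) (z : Fin n → EuclideanSpace ℝ (Fin d)) (k r : ℝ) :
    k / n ≤ ⨆ x : EuclideanSpace ℝ (Fin d), empRisk z (ballInd x r) ↔
      ∃ x, k ≤ (ballIndices z x r).card := by
  have hn' : (0 : ℝ) < n := by exact_mod_cast hn
  constructor
  · intro h
    obtain ⟨x, hx⟩ := (Set.range_nonempty _).csSup_mem (finite_range_empRisk z r)
    refine ⟨x, ?_⟩
    rw [iSup, ← hx] at h
    simp only [empRisk_ballInd] at h
    exact (div_le_div_iff_of_pos_right hn').1 h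
  · rintro ⟨x, hx⟩
    refine le_trans ?_ (le_ciSup (finite_range_empRisk z r).bddAbove x)
    rw [empRisk_ballInd]
    gcongr

lemma empRadius_le (hn : 0 < n) {z : Fin n → EuclideanSpace ℝ (Fin d)} {k r : ℝ} (hr : 0 ≤ r)
    {x : EuclideanSpace ℝ (Fin d)} (hx : k ≤ (ballIndices z x r).card) : empRadius z k ≤ r :=
  csInf_le ⟨0, fun _ h => h.1⟩ ⟨hr, (le_iSup_empRisk_iff hn z k r).2 ⟨x, hx⟩⟩

lemma subset_ballIndices_chebyshevCenter (z : Fin n → EuclideanSpace ℝ (Fin d))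
    (T : Finset (Fin n)) :
    T ⊆ ballIndices z (chebyshevCenter fun i : T => z i) (chebyshevRadius fun i : T => z i) :=
  fun i hi => by
    simpa [ballIndices] using dist_chebyshevCenter_le (fun i : T => z i) ⟨i, hi⟩

lemma card_le_card_ballIndices_chebyshevCenter (z : Fin n → EuclideanSpace ℝ (Fin d))
    (T : Finset (Fin n)) :
    (T.card : ℝ) ≤ (ballIndices z (chebyshevCenter fun i : T => z i)
      (chebyshevRadius fun i : T => z i)).card := by
  exact_mod_cast Finset.card_le_card (subset_ballIndices_chebyshevCenter z T)

lemma empRadius_le_chebyshevRadius (hn : 0 < n) (z : Fin n → EuclideanSpace ℝ (Fin d)) {k : ℝ}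
    {T : Finset (Fin n)} (hT : k ≤ T.card) :
    empRadius z k ≤ chebyshevRadius fun i : T => z i :=
  empRadius_le hn (chebyshevRadius_nonneg _) 
    (hT.trans (card_le_card_ballIndices_chebyshevCenter z T))

/-- The infimum that defines the empirical radius is attained. -/
lemma exists_le_card_ballIndices_empRadius (hn : 0 < n) (z : Fin n → EuclideanSpace ℝ (Fin d))
    {k : ℝ} (hk : k ≤ n) : ∃ x, k ≤ (ballIndices z x (empRadius z k)).card := by
  classical
  -- Only finitely many index sets compete, so one with the smallest enclosing ball exists.
  obtain ⟨T, hT, hmin⟩ := Finset.exists_min_image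
    (Finset.univ.filter fun T : Finset (Fin n) => k ≤ T.card)
    (fun T => chebyshevRadius fun i : T => z i) ⟨Finset.univ, by simpa using hk⟩
  simp only [Finset.mem_filter, Finset.mem_univ, true_and] at hT hmin
  have hle : (chebyshevRadius fun i : T => z i) ≤ empRadius z k := by
    refine le_csInf ⟨_, chebyshevRadius_nonneg _, (le_iSup_empRisk_iff hn z k _).2 ⟨_, hT.trans
      (card_le_card_ballIndices_chebyshevCenter z T)⟩⟩ ?_
    rintro r ⟨hr, h⟩
    obtain ⟨x, hx⟩ := (le_iSup_empRisk_iff hn z k r).1 h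
    refine (hmin _ hx).trans (chebyshevRadius_le hr (x := x) fun i => ?_)
    exact (Finset.mem_filter.1 i.2).2
  rw [(empRadius_le_chebyshevRadius hn z hT).antisymm hle]
  exact ⟨_, hT.trans (card_le_card_ballIndices_chebyshevCenter z T)⟩

lemma IsShorth.le_card (hn : 0 < n) {z : Fin n → EuclideanSpace ℝ (Fin d)} {k : ℝ} (hk : k ≤ n)
    {m : EuclideanSpace ℝ (Fin d)} (hm : IsShorth z k m) :
    k ≤ (ballIndices z m (empRadius z k)).card := by
  obtain ⟨x, hx⟩ := exists_le_card_ballIndices_empRadius hn z hk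
  have h := hm x
  rw [empRisk_ballInd, empRisk_ballInd, div_le_div_iff_of_pos_right (by exact_mod_cast hn)] at h
  exact hx.trans h

/-- A `k`-shorth is the Chebyshev centre of some `d + 1` of the data points. -/
lemma IsShorth.exists_eq_chebyshevCenter (hn : 0 < n) {z : Fin n → EuclideanSpace ℝ (Fin d)}
    {k : ℝ} (hk : k ≤ n) (hd : (d : ℝ) + 1 ≤ k) {m : EuclideanSpace ℝ (Fin d)}
    (hm : IsShorth z k m) :
    ∃ S : Finset (Fin n), S.card = d + 1 ∧ m = chebyshevCenter fun i : S => z i := by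
  have hcard := hm.le_card hn hk
  set T := ballIndices z m (empRadius z k)
  have hdT : Module.finrank ℝ (EuclideanSpace ℝ (Fin d)) + 1 ≤ T.card := by
    rw [finrank_euclideanSpace_fin]
    exact_mod_cast hd.trans hcard
  have : Nonempty T := (Finset.card_pos.1 (by omega)).to_subtype
  obtain ⟨S, -, hS, h⟩ := exists_subset_chebyshevCenter_eq z T hdT
  refine ⟨S, by simpa using hS, ?_⟩
  rw [← h]
  refine eq_chebyshevCenter fun i => le_trans ?_ (empRadius_le_chebyshevRadius hn z hcard)
  exact (Finset.mem_filter.1 i.2).2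

end Shorth
-- Ball masses under a radial unimodal law
section RadialUnimodal

variable {d : ℕ} {ν : Measure (EuclideanSpace ℝ (Fin d))}

/-- Anderson's inequality for balls: under a radially symmetric unimodal law the ball centred at
the origin is the most likely one of its radius. -/
lemma IsRadialUnimodal.measure_closedBall_le (h : IsRadialUnimodal ν)
    (x : EuclideanSpace ℝ (Fin d)) (r : ℝ) :
    ν (Metric.closedBall x r) ≤ ν (Metric.closedBall 0 r) := by
  obtain ⟨g, hg, rfl⟩ := h
  rcases lt_or_ge r 0 with hr | hr
  · simp [Metric.closedBall_eq_empty.2 hr]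
  set A := Metric.closedBall x r
  set B := Metric.closedBall (0 : EuclideanSpace ℝ (Fin d)) r
  have hA : MeasurableSet A := measurableSet_closedBall
  have hB : MeasurableSet B := measurableSet_closedBall
  have hvol : volume (A \ B) = volume (B \ A) := by
    have hAB : volume A = volume B := by
      simp only [A, B, Measure.addHaar_closedBall _ _ hr]
    have h1 := measure_inter_add_sdiff (μ := volume) A hB
    have h2 := measure_inter_add_sdiff (μ := volume) B hA
    rw [Set.inter_comm, ← hAB, ← h1, Set.inter_comm] at h2
    refine ((ENNReal.add_right_inj ?_).1 h2).symm
    exact ne_top_of_le_ne_top (measure_closedBall_lt_top (x := x) (r := r)).ne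
      (measure_mono Set.inter_subset_right)
  rw [← measure_inter_add_sdiff A hB, ← measure_inter_add_sdiff B hA, Set.inter_comm B A]
  gcongr 1
  rw [withDensity_apply _ (hA.diff hB), withDensity_apply _ (hB.diff hA)]
  -- The two differences have equal volume; the density is at most `g r` outside `B` and at least `g
  -- r` inside.
  calc ∫⁻ y in A \ B, g ‖y‖ ≤ ∫⁻ _ in A \ B, g r := by
        refine setLIntegral_mono' (hA.diff hB) fun y hy => hg hr (norm_nonneg y) ?_
        have := hy.2
        simp only [B, mem_closedBall_zero_iff, not_le] at this
        exact this.le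
    _ = ∫⁻ _ in B \ A, g r := by rw [setLIntegral_const, setLIntegral_const, hvol]
    _ ≤ ∫⁻ y in B \ A, g ‖y‖ := by
        refine setLIntegral_mono' (hB.diff hA) fun y hy => hg (norm_nonneg y) hr ?_
        simpa [B] using hy.1

/-- Under a radially symmetric unimodal law, the mass of a ball is at most a `(r / s) ^ d` fraction
of the total mass when the ball lies outside the ball of radius `s` about the origin. -/
lemma IsRadialUnimodal.mul_measure_closedBall_le (h : IsRadialUnimodal ν)
    (x : EuclideanSpace ℝ (Fin d)) {r s : ℝ} (hr : 0 ≤ r) (hs : 0 ≤ s) (hx : s + r ≤ ‖x‖) {b : ℝ}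
    (hb : 0 ≤ b) (hbs : b * r ^ d ≤ s ^ d) :
    ENNReal.ofReal b * ν (Metric.closedBall x r) ≤ ν Set.univ := by
  obtain ⟨g, hg, rfl⟩ := h
  have h1 : (volume.withDensity fun y => g ‖y‖) (Metric.closedBall x r) ≤
      g s * volume (Metric.closedBall x r) := by
    rw [withDensity_apply _ measurableSet_closedBall, ← setLIntegral_const]
    refine setLIntegral_mono' measurableSet_closedBall fun y hy => hg hs (norm_nonneg y) ?_
    have h1 := norm_sub_norm_le x y
    rw [mem_closedBall_iff_norm'] at hy
    linarith
  have h2 : g s * volume (Metric.closedBall (0 : EuclideanSpace ℝ (Fin d)) s) ≤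
      (volume.withDensity fun y : EuclideanSpace ℝ (Fin d) => g ‖y‖) (Metric.closedBall 0 s) := by
    rw [withDensity_apply _ measurableSet_closedBall, ← setLIntegral_const]
    refine setLIntegral_mono' measurableSet_closedBall fun y hy => hg (norm_nonneg y) hs ?_
    simpa using hy
  refine le_trans ?_ (h2.trans (measure_mono (Set.subset_univ _)))
  refine (mul_le_mul_right h1 _).trans ?_
  rw [Measure.addHaar_closedBall _ _ hr, Measure.addHaar_closedBall _ _ hs,
    finrank_euclideanSpace_fin]
  rw [mul_left_comm, ← mul_assoc (ENNReal.ofReal b), ← ENNReal.ofReal_mul hb]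
  gcongr

end RadialUnimodal

/-! ### The mixture and its population radius -/

section Mixture

variable {d n : ℕ} {Ω : Type*} [MeasurableSpace Ω] {P : Measure Ω}
  {X : Fin n → Ω → EuclideanSpace ℝ (Fin d)}

lemma measurable_ballInd (x : EuclideanSpace ℝ (Fin d)) (r : ℝ) : Measurable (ballInd x r) :=
  measurable_const.indicator measurableSet_closedBall

lemma integral_ballInd_comp {Y : Ω → EuclideanSpace ℝ (Fin d)} (hY : Measurable Y)
    (x : EuclideanSpace ℝ (Fin d)) (r : ℝ) :
    ∫ ω, ballInd x r (Y ω) ∂P = (P.map Y).real (Metric.closedBall x r) := by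
  rw [← integral_map hY.aemeasurable (measurable_ballInd x r).aestronglyMeasurable]
  exact integral_indicator_one measurableSet_closedBall

lemma isProbabilityMeasure_mixtureLaw [IsProbabilityMeasure P] (hn : 0 < n)
    (hX : ∀ i, Measurable (X i)) :
    IsProbabilityMeasure (mixtureLaw P X) := by
  constructor
  have : ∀ i, P.map (X i) Set.univ = 1 := fun i =>
    (Measure.isProbabilityMeasure_map (hX i).aemeasurable).measure_univ
  simp only [mixtureLaw, Measure.smul_apply, Measure.coe_finsetSum, Finset.sum_apply, this,
    Finset.sum_const, Finset.card_univ, Fintype.card_fin, smul_eq_mul, nsmul_eq_mul, mul_one]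
  exact ENNReal.inv_mul_cancel (by exact_mod_cast hn.ne') (ENNReal.natCast_ne_top n)

lemma popRisk_ballInd [IsProbabilityMeasure P] (hX : ∀ i, Measurable (X i))
    (x : EuclideanSpace ℝ (Fin d)) (r : ℝ) :
    popRisk P X (ballInd x r) = (mixtureLaw P X).real (Metric.closedBall x r) := by
  have hp : ∀ i, IsProbabilityMeasure (P.map (X i)) := fun i =>
    Measure.isProbabilityMeasure_map (hX i).aemeasurable
  rw [popRisk, mixtureLaw, Measure.real, Measure.smul_apply, smul_eq_mul, ENNReal.toReal_mul,
    Measure.coe_finsetSum, Finset.sum_apply, ENNReal.toReal_sum (fun i _ => measure_ne_top _ _)]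
  simp [integral_ballInd_comp (hX _), Measure.real]

lemma sum_integral_ballInd (hn : 0 < n) (x : EuclideanSpace ℝ (Fin d)) (r : ℝ) :
    ∑ i, ∫ ω, ballInd x r (X i ω) ∂P = n * popRisk P X (ballInd x r) := by
  have : (n : ℝ) ≠ 0 := by exact_mod_cast hn.ne'
  rw [popRisk]
  field_simp

/-- The infimum that defines the population radius is attained, by a ball about the origin. -/
lemma le_popRisk_popRadius [IsProbabilityMeasure P] (hn : 0 < n) (hX : ∀ i, Measurable (X i))
    (hν : IsRadialUnimodal (mixtureLaw P X)) {k : ℝ} (htop : popRadius P X k ≠ ⊤) :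
    k / n ≤ popRisk P X (ballInd 0 (popRadius P X k).toReal) := by
  have := isProbabilityMeasure_mixtureLaw (P := P) hn hX
  set ν := mixtureLaw P X
  set ρ := popRadius P X k with hρ
  -- Anderson moves the ball to the origin for every larger radius; continuity from above then
  -- reaches `ρ` itself.
  have hgt : ∀ r, ρ.toReal < r → k / n ≤ ν.real (Metric.closedBall 0 r) := fun r hr => by
    have h1 : ρ < ENNReal.ofReal r := (ENNReal.lt_ofReal_iff_toReal_lt htop).2 hr
    rw [hρ, popRadius] at h1
    simp only [iInf_lt_iff] at h1
    obtain ⟨s, ⟨hs, hsk⟩, hsr⟩ := h1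
    refine hsk.trans (ciSup_le fun x => ?_)
    rw [popRisk_ballInd hX]
    have hsr' : s < r := (ENNReal.ofReal_lt_ofReal_iff'.1 hsr).1
    exact ENNReal.toReal_mono (measure_ne_top _ _) ((hν.measure_closedBall_le x s).trans
      (measure_mono (Metric.closedBall_subset_closedBall hsr'.le)))
  rw [popRisk_ballInd hX]
  obtain ⟨u, hu, hlt, hlim⟩ := exists_seq_strictAnti_tendsto ρ.toReal
  have hinter : ⋂ j, Metric.closedBall (0 : EuclideanSpace ℝ (Fin d)) (u j) =
      Metric.closedBall 0 ρ.toReal := by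
    ext y
    simp only [Set.mem_iInter, mem_closedBall_zero_iff]
    exact ⟨fun h => ge_of_tendsto' hlim h, fun h j => h.trans (hlt j).le⟩
  have ht := tendsto_measure_iInter_atTop (μ := ν)
    (s := fun j => Metric.closedBall (0 : EuclideanSpace ℝ (Fin d)) (u j))
    (fun j => measurableSet_closedBall.nullMeasurableSet)
    (fun i j hij => Metric.closedBall_subset_closedBall (hu.antitone hij))
    ⟨0, measure_ne_top _ _⟩
  rw [hinter] at ht
  exact ge_of_tendsto' ((ENNReal.tendsto_toReal (measure_ne_top _ _)).comp ht)
    fun j => hgt (u j) (hlt j)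

/-- A ball of radius `r` far from the origin has small mass under the mixture. -/
lemma popRisk_le_of_norm_gt [IsProbabilityMeasure P] (hd : 1 ≤ d) (hn : 0 < n)
    (hX : ∀ i, Measurable (X i))
    (hν : IsRadialUnimodal (mixtureLaw P X)) {k r : ℝ} (hk : 0 < k) (hkn : k ≤ n) (hr : 0 ≤ r)
    {x : EuclideanSpace ℝ (Fin d)} (hx : 4 * r * (2 * n / k) ^ (1 / (d : ℝ)) < ‖x‖) :
    n * popRisk P X (ballInd x r) ≤ k / 6 := by
  have := isProbabilityMeasure_mixtureLaw (P := P) hn hX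
  have hn' : (0 : ℝ) < n := by exact_mod_cast hn
  set a := (2 * n / k) ^ (1 / (d : ℝ)) with ha
  have hnk : 1 ≤ 2 * n / k := by rw [le_div_iff₀ hk]; linarith
  have ha1 : 1 ≤ a := Real.one_le_rpow hnk (by positivity)
  have had : a ^ d = 2 * n / k := by
    rw [ha, one_div, Real.rpow_inv_natCast_pow (by positivity) (by omega)]
  have hra : r ≤ r * a := le_mul_of_one_le_right hr ha1
  have h3 : (3 : ℝ) ≤ 3 ^ d := le_self_pow₀ (by norm_num) (by omega)
  -- With `a ^ d = 2n/k`, the radius `s = 3ra` leaves room for `r ≤ ra`, and `3 ≤ 3 ^ d` gives the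
  -- ratio `6n/k`.
  have key := hν.mul_measure_closedBall_le x (s := 3 * r * a) hr (by positivity) (by linarith)
    (b := 6 * n / k) (by positivity) (by
      rw [mul_pow, mul_pow, had]
      have : 6 * n / k * r ^ d = 3 * r ^ d * (2 * n / k) := by ring
      rw [this]
      gcongr)
  rw [measure_univ] at key
  have key' := ENNReal.toReal_mono ENNReal.one_ne_top key
  rw [ENNReal.toReal_mul, ENNReal.toReal_ofReal (by positivity), ENNReal.toReal_one] at key'
  rw [popRisk_ballInd hX]
  change 6 * n / k * (mixtureLaw P X).real _ ≤ 1 at key'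
  rw [div_mul_eq_mul_div, div_le_one hk] at key'
  linarith

end Mixture

/-! ### Chernoff bounds for ball counts -/

section Chernoff

variable {d n : ℕ} {Ω : Type*} [MeasurableSpace Ω] {P : Measure Ω} [IsProbabilityMeasure P]
  {X : Fin n → Ω → EuclideanSpace ℝ (Fin d)}

lemma integrable_ballInd_comp {Y : Ω → EuclideanSpace ℝ (Fin d)} (hY : Measurable Y)
    (x : EuclideanSpace ℝ (Fin d)) (r : ℝ) : Integrable (fun ω => ballInd x r (Y ω)) P := by
  refine Integrable.of_bound ((measurable_ballInd x r).comp hY).aestronglyMeasurable 1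
    (ae_of_all _ fun ω => ?_)
  rw [ballInd_apply]
  split_ifs <;> simp

/-- On the values `0` and `1` the exponential is affine, so the moment generating function is `1 + u
≤ exp u`. -/
lemma mgf_ballInd_le {Y : Ω → EuclideanSpace ℝ (Fin d)} (hY : Measurable Y)
    (x : EuclideanSpace ℝ (Fin d)) (r t : ℝ) :
    mgf (fun ω => ballInd x r (Y ω)) P t ≤
      Real.exp ((Real.exp t - 1) * ∫ ω, ballInd x r (Y ω) ∂P) := by
  have h : ∀ ω, Real.exp (t * ballInd x r (Y ω)) =
      (Real.exp t - 1) * ballInd x r (Y ω) + 1 := fun ω => by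
    rw [ballInd_apply]
    split_ifs <;> simp
  have : mgf (fun ω => ballInd x r (Y ω)) P t =
      (Real.exp t - 1) * ∫ ω, ballInd x r (Y ω) ∂P + 1 := by
    rw [mgf]
    simp only [h]
    rw [integral_add ((integrable_ballInd_comp hY x r).const_mul _) (integrable_const _),
      integral_const_mul]
    simp
  rw [this]
  exact Real.add_one_le_exp _

lemma mgf_sum_ballInd_le (hX : ∀ i, Measurable (X i)) (hind : iIndepFun X P)
    (S : Finset (Fin n)) (x : EuclideanSpace ℝ (Fin d)) (r t : ℝ) :
    mgf (∑ i ∈ S, fun ω => ballInd x r (X i ω)) P t ≤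
      Real.exp ((Real.exp t - 1) * ∑ i ∈ S, ∫ ω, ballInd x r (X i ω) ∂P) := by
  have hind' := hind.comp (fun _ => ballInd x r) fun _ => measurable_ballInd x r
  have := hind'.mgf_sum (t := t) (fun i => (measurable_ballInd x r).comp (hX i)) S
  simp only [Function.comp_def] at this
  rw [this, Finset.mul_sum, Real.exp_sum]
  exact Finset.prod_le_prod (fun _ _ => mgf_nonneg) fun i _ => mgf_ballInd_le (hX i) x r t

lemma integrable_exp_mul_sum_ballInd (hX : ∀ i, Measurable (X i))
    (S : Finset (Fin n)) (x : EuclideanSpace ℝ (Fin d)) (r t : ℝ) :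
    Integrable (fun ω => Real.exp (t * (∑ i ∈ S, fun ω => ballInd x r (X i ω)) ω)) P := by
  have hm : Measurable fun ω => Real.exp (t * (∑ i ∈ S, fun ω => ballInd x r (X i ω)) ω) := by
    have : ∀ i, Measurable fun ω => ballInd x r (X i ω) :=
      fun i => (measurable_ballInd x r).comp (hX i)
    simp only [Finset.sum_apply]
    exact ((Finset.measurable_sum S fun i _ => this i).const_mul t).exp
  refine Integrable.of_bound hm.aestronglyMeasurable (Real.exp (|t| * S.card))
    (ae_of_all _ fun ω => ?_)
  rw [Real.norm_of_nonneg (Real.exp_pos _).le, Real.exp_le_exp, Finset.sum_apply, sum_ballInd]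
  have h1 : ((S ∩ ballIndices (fun i => X i ω) x r).card : ℝ) ≤ S.card := by
    exact_mod_cast Finset.card_le_card Finset.inter_subset_left
  have := le_abs_self t
  have := abs_nonneg t
  gcongr

lemma measureReal_card_ballIndices_ge_le (hX : ∀ i, Measurable (X i)) (hind : iIndepFun X P)
    (S : Finset (Fin n)) (x : EuclideanSpace ℝ (Fin d)) (r : ℝ) {k : ℝ} (hk : 0 ≤ k)
    (hmean : ∑ i ∈ S, ∫ ω, ballInd x r (X i ω) ∂P ≤ k / 6) :
    P.real {ω | k / 2 ≤ ((S ∩ ballIndices (fun i => X i ω) x r).card : ℝ)} ≤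
      Real.exp (-(k / 5)) := by
  have h := measure_ge_le_exp_mul_mgf (μ := P) (X := ∑ i ∈ S, fun ω => ballInd x r (X i ω))
    (k / 2) zero_le_one (integrable_exp_mul_sum_ballInd hX S x r 1)
  simp only [Finset.sum_apply, sum_ballInd (fun i => X i _)] at h
  refine h.trans ((mul_le_mul_of_nonneg_left (mgf_sum_ballInd_le hX hind S x r 1)
    (Real.exp_pos _).le).trans ?_)
  rw [← Real.exp_add, Real.exp_le_exp]
  have he := Real.exp_one_lt_d9
  have he' : 0 ≤ Real.exp 1 - 1 := by linarith [Real.add_one_le_exp (1 : ℝ)]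
  have h1 := mul_le_mul_of_nonneg_left hmean he'
  -- The exponent is at most `-k/2 + 1.72 k/6 < -k/5`.
  have h2 : (Real.exp 1 - 1) * (k / 6) ≤ 1.72 * (k / 6) := by gcongr; linarith
  linarith

lemma measureReal_card_ballIndices_le_le (hX : ∀ i, Measurable (X i)) (hind : iIndepFun X P)
    (x : EuclideanSpace ℝ (Fin d)) (r : ℝ) {k : ℝ} (hk : 0 ≤ k)
    (hmean : 2 * k ≤ ∑ i, ∫ ω, ballInd x r (X i ω) ∂P) :
    P.real {ω | ((ballIndices (fun i => X i ω) x r).card : ℝ) ≤ k} ≤ Real.exp (-(k / 5)) := by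
  have h := measure_le_le_exp_mul_mgf (μ := P) (X := ∑ i, fun ω => ballInd x r (X i ω))
    k (neg_nonpos.2 zero_le_one) (integrable_exp_mul_sum_ballInd hX Finset.univ x r (-1))
  simp only [Finset.sum_apply, sum_ballInd (fun i => X i _), Finset.univ_inter] at h
  refine h.trans ((mul_le_mul_of_nonneg_left (mgf_sum_ballInd_le hX hind Finset.univ x r (-1))
    (Real.exp_pos _).le).trans ?_)
  rw [← Real.exp_add, Real.exp_le_exp]
  -- The exponent is at most `k - 0.6 * 2k = -k/5`.
  have he : Real.exp (-1) ≤ 0.4 := by linarith [Real.exp_neg_one_lt_d9]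
  have h1 := mul_le_mul_of_nonneg_left hmean (sub_nonneg.2 (he.trans (by norm_num : (0.4 : ℝ) ≤ 1)))
  have h2 : Real.exp (-1) * k ≤ 0.4 * k := by gcongr
  nlinarith

end Chernoff
-- Data-dependent centres and the union bound
section UnionBound

variable {d n : ℕ} {Ω : Type*} [MeasurableSpace Ω] {P : Measure Ω} [IsProbabilityMeasure P]
  {X : Fin n → Ω → EuclideanSpace ℝ (Fin d)}

/-- If every ball of radius `r` with centre outside the ball of radius `R` has small mass, then the
ball of radius `r` about the Chebyshev centre of a given set of data points is unlikely to be such a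
ball and to contain many of the other data points. -/
lemma measureReal_chebyshevCenter_far_le (hn : 0 < n) (hX : ∀ i, Measurable (X i))
    (hind : iIndepFun X P) {S : Finset (Fin n)} (hS : S.Nonempty) {k r R : ℝ} (hk : 0 ≤ k)
    (hmean : ∀ x : EuclideanSpace ℝ (Fin d), R < ‖x‖ → n * popRisk P X (ballInd x r) ≤ k / 6) :
    P.real {ω | R < ‖chebyshevCenter fun i : S => X i ω‖ ∧
      k / 2 ≤ ((Sᶜ ∩ ballIndices (fun i => X i ω)
        (chebyshevCenter fun i : S => X i ω) r).card : ℝ)} ≤ Real.exp (-(k / 5)) := by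
  have : Nonempty S := hS.to_subtype
  let Y : Ω → S → EuclideanSpace ℝ (Fin d) := fun ω i => X i ω
  let Z : Ω → (Sᶜ : Finset (Fin n)) → EuclideanSpace ℝ (Fin d) := fun ω i => X i ω
  have hY : Measurable Y := measurable_pi_lambda _ fun i => hX i
  have hZ : Measurable Z := measurable_pi_lambda _ fun i => hX i
  have hYZ : IndepFun Y Z P := hind.indepFun_finset S Sᶜ disjoint_compl_right hX
  have hprod := (indepFun_iff_map_prod_eq_prod_map_map hY.aemeasurable hZ.aemeasurable).1 hYZ
  have hc : Measurable (chebyshevCenter : (S → EuclideanSpace ℝ (Fin d)) → _) :=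
    continuous_chebyshevCenter.measurable
  let D : Set ((S → EuclideanSpace ℝ (Fin d)) ×
      ((Sᶜ : Finset (Fin n)) → EuclideanSpace ℝ (Fin d))) :=
    {q | R < ‖chebyshevCenter q.1‖ ∧ k / 2 ≤ ∑ i, ballInd (chebyshevCenter q.1) r (q.2 i)}
  have hD : MeasurableSet D := by
    have hsum : Measurable fun q : (S → EuclideanSpace ℝ (Fin d)) ×
        ((Sᶜ : Finset (Fin n)) → EuclideanSpace ℝ (Fin d)) =>
        ∑ i, ballInd (chebyshevCenter q.1) r (q.2 i) := by
      refine Finset.measurable_sum _ fun i _ => ?_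
      simp only [ballInd_apply]
      exact Measurable.ite (measurableSet_le (((measurable_pi_apply i).comp measurable_snd).dist
        (hc.comp measurable_fst)) measurable_const) measurable_const measurable_const
    exact (measurableSet_lt measurable_const (hc.comp measurable_fst).norm).inter
      (measurableSet_le measurable_const hsum)
  have hsum : ∀ (ω : Ω) (x : EuclideanSpace ℝ (Fin d)), ∑ i, ballInd x r (Z ω i) =
      ((Sᶜ ∩ ballIndices (fun i => X i ω) x r).card : ℝ) := fun ω x => by
    rw [← sum_ballInd]
    exact Finset.sum_coe_sort Sᶜ fun i => ballInd x r (X i ω)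
  have hev : {ω | R < ‖chebyshevCenter fun i : S => X i ω‖ ∧
      k / 2 ≤ ((Sᶜ ∩ ballIndices (fun i => X i ω)
        (chebyshevCenter fun i : S => X i ω) r).card : ℝ)} = (fun ω => (Y ω, Z ω)) ⁻¹' D := by
    ext ω
    simp only [Set.mem_ofPred_eq, Set.mem_preimage, D, hsum]
    rfl
  have : IsProbabilityMeasure (P.map Y) := Measure.isProbabilityMeasure_map hY.aemeasurable
  have hle : P ((fun ω => (Y ω, Z ω)) ⁻¹' D) ≤ ENNReal.ofReal (Real.exp (-(k / 5))) := by
    -- By Fubini, the points of `S` are frozen at `y` and the fixed-centre bound applies to the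
    -- rest.
    rw [← Measure.map_apply (hY.prodMk hZ) hD, hprod, Measure.prod_apply hD]
    refine (lintegral_mono (g := fun _ => ENNReal.ofReal (Real.exp (-(k / 5)))) fun y => ?_).trans
      (by simp)
    rw [Measure.map_apply hZ (measurable_prodMk_left hD)]
    by_cases hy : R < ‖chebyshevCenter y‖
    · have hS' : ∑ i ∈ Sᶜ, ∫ ω, ballInd (chebyshevCenter y) r (X i ω) ∂P ≤ k / 6 := by
        refine le_trans ?_ (hmean _ hy)
        rw [← sum_integral_ballInd hn]
        refine Finset.sum_le_sum_of_subset_of_nonneg (Finset.subset_univ _) fun i _ _ =>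
          integral_nonneg fun ω => ?_
        rw [ballInd_apply]
        split_ifs <;> simp
      have h := measureReal_card_ballIndices_ge_le hX hind Sᶜ (chebyshevCenter y) r hk hS'
      rw [← ofReal_measureReal]
      refine ENNReal.ofReal_le_ofReal (le_trans (measureReal_mono ?_) h)
      rintro ω ⟨-, hω⟩
      simpa only [Set.mem_ofPred_eq, ← hsum] using hω
    · have : Z ⁻¹' (Prod.mk y ⁻¹' D) = ∅ := by
        ext ω
        simp [D, hy]
      simp [this]
  rw [hev, Measure.real]
  exact ENNReal.toReal_le_of_le_ofReal (Real.exp_pos _).le hle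

lemma norm_le_of_isShorth (hn : 0 < n) {z : Fin n → EuclideanSpace ℝ (Fin d)} {k r R : ℝ}
    (hkn : k ≤ n) (hd : 2 * ((d : ℝ) + 1) ≤ k) (hr : 0 ≤ r)
    (h0 : k ≤ (ballIndices z 0 r).card)
    (hfar : ∀ S : Finset (Fin n), S.card = d + 1 → R < ‖chebyshevCenter fun i : S => z i‖ →
      ((Sᶜ ∩ ballIndices z (chebyshevCenter fun i : S => z i) r).card : ℝ) < k / 2)
    {m : EuclideanSpace ℝ (Fin d)} (hm : IsShorth z k m) : ‖m‖ ≤ R := by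
  by_contra! hR
  have hd0 : (0 : ℝ) ≤ d := d.cast_nonneg
  obtain ⟨S, hS, rfl⟩ := hm.exists_eq_chebyshevCenter hn hkn (by linarith)
  have hlt := hfar S hS hR
  set c := chebyshevCenter fun i : S => z i
  have hcard := hm.le_card hn hkn
  have hsub : ballIndices z c (empRadius z k) ⊆ S ∪ (Sᶜ ∩ ballIndices z c r) := fun i hi => by
    have h1 := (Finset.mem_filter.1 hi).2.trans (empRadius_le hn hr h0)
    by_cases h : i ∈ S <;> simp [ballIndices, h, h1]
  have h2 := (Finset.card_le_card hsub).trans (Finset.card_union_le _ _)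
  rw [hS] at h2
  have h3 : ((ballIndices z c (empRadius z k)).card : ℝ) ≤
      d + 1 + (Sᶜ ∩ ballIndices z c r).card := by exact_mod_cast h2
  linarith

lemma choose_mul_exp_le {n e : ℕ} {k : ℝ} (hn : 0 < n)
    (hk : 2 * (e * Real.log n) ≤ k / 5) :
    (n.choose e : ℝ) * Real.exp (-(k / 5)) ≤ Real.exp (-(e * Real.log n)) := by
  have hn' : (0 : ℝ) < n := by exact_mod_cast hn
  have h1 : (n.choose e : ℝ) ≤ Real.exp (e * Real.log n) := by
    rw [Real.exp_nat_mul, Real.exp_log hn']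
    exact_mod_cast Nat.choose_le_pow n e
  calc (n.choose e : ℝ) * Real.exp (-(k / 5))
      ≤ Real.exp (e * Real.log n) * Real.exp (-(k / 5)) := by gcongr
    _ ≤ Real.exp (-(e * Real.log n)) := by
        rw [← Real.exp_add, Real.exp_le_exp]
        linarith

end UnionBound

theorem mainTheorem5 :
    ∃ C c' : ℝ, 0 < C ∧ 0 < c' ∧
      ∀ (d n : ℕ) (k : ℝ), 1 ≤ d → 2 ≤ k → k ≤ n → C * ((d : ℝ) + 1) * Real.log n ≤ k →
      ∀ (Ω : Type*) [MeasurableSpace Ω] (P : Measure Ω) [IsProbabilityMeasure P]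
        (X : Fin n → Ω → EuclideanSpace ℝ (Fin d)),
        (∀ i, Measurable (X i)) → iIndepFun X P → IsRadialUnimodal (mixtureLaw P X) →
        ∃ A : Set Ω, MeasurableSet A ∧
          1 - 2 * Real.exp (-(c' * d * Real.log n)) ≤ P.real A ∧
          ∀ ω ∈ A, ∀ m : EuclideanSpace ℝ (Fin d), IsShorth (fun i => X i ω) k m →
            ENNReal.ofReal ‖m‖ ≤
              4 * popRadius P X (2 * k) * ENNReal.ofReal ((2 * n / k) ^ (1 / (d : ℝ))) := by
  -- `C = 10` makes `k/5 ≥ 2(d + 1) log n`: one half pays for the choice of `S`, the other is the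
  -- stated probability.
  refine ⟨10, 1, by norm_num, by norm_num, ?_⟩
  intro d n k hd hk2 hkn hkC Ω _ P _ X hX hind hν
  have hk : 0 < k := by linarith
  have hn2 : (2 : ℝ) ≤ n := hk2.trans hkn
  have hn : 0 < n := by
    have : (0 : ℝ) < n := by linarith
    exact_mod_cast this
  have hn' : (0 : ℝ) < n := by exact_mod_cast hn
  have ha : 0 < (2 * n / k) ^ (1 / (d : ℝ)) := by positivity
  by_cases htop : popRadius P X (2 * k) = ⊤
  -- An infinite radius, as when `2k > n`, makes the bound trivial.
  · refine ⟨Set.univ, MeasurableSet.univ, ?_, fun ω _ m _ => ?_⟩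
    · simp only [probReal_univ]
      linarith [Real.exp_pos (-(1 * d * Real.log n))]
    · rw [htop, ENNReal.mul_top (by norm_num), ENNReal.top_mul (by simpa using ha)]
      exact le_top
  set r := (popRadius P X (2 * k)).toReal with hr_def
  have hr : 0 ≤ r := ENNReal.toReal_nonneg
  set R := 4 * r * (2 * n / k) ^ (1 / (d : ℝ)) with hR
  have hlog : 0.69 ≤ Real.log n := by
    have := Real.log_le_log zero_lt_two hn2
    linarith [Real.log_two_gt_d9]
  have hd0 : (0 : ℝ) ≤ d := d.cast_nonneg
  have hdk : 2 * ((d : ℝ) + 1) ≤ k := by nlinarith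
  have hlow := le_popRisk_popRadius hn hX hν htop
  rw [div_le_iff₀ hn', mul_comm _ (n : ℝ), ← sum_integral_ballInd hn, ← hr_def] at hlow
  let bad₀ : Set Ω := {ω | ((ballIndices (fun i => X i ω) 0 r).card : ℝ) ≤ k}
  let bad : Finset (Fin n) → Set Ω := fun S =>
    {ω | R < ‖chebyshevCenter fun i : S => X i ω‖ ∧
      k / 2 ≤ ((Sᶜ ∩ ballIndices (fun i => X i ω)
        (chebyshevCenter fun i : S => X i ω) r).card : ℝ)}
  let B := bad₀ ∪ ⋃ S ∈ Finset.univ.powersetCard (d + 1), bad S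
  have hB : P.real B ≤ 2 * Real.exp (-(1 * d * Real.log n)) := by
    have h0 : P.real bad₀ ≤ Real.exp (-(k / 5)) :=
      measureReal_card_ballIndices_le_le hX hind 0 r hk.le hlow
    have h1 : P.real (⋃ S ∈ Finset.univ.powersetCard (d + 1), bad S) ≤
        (n.choose (d + 1) : ℝ) * Real.exp (-(k / 5)) := by
      refine (measureReal_biUnion_finset_le _ _).trans ((Finset.sum_le_card_nsmul _ _
        (Real.exp (-(k / 5)))
        fun S hS => ?_).trans_eq ?_)
      · exact measureReal_chebyshevCenter_far_le hn hX hind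
          (Finset.card_pos.1 (by rw [(Finset.mem_powersetCard.1 hS).2]; omega)) hk.le
          fun x hx => popRisk_le_of_norm_gt hd hn hX hν hk hkn hr hx
      · rw [nsmul_eq_mul, Finset.card_powersetCard, Finset.card_univ, Fintype.card_fin]
    have h2 := choose_mul_exp_le (n := n) (e := d + 1) (k := k) hn (by push_cast; linarith)
    have h3 : Real.exp (-(((d + 1 : ℕ) : ℝ) * Real.log n)) ≤ Real.exp (-(1 * d * Real.log n)) := by
      rw [Real.exp_le_exp]
      push_cast
      linarith
    have h4 : Real.exp (-(k / 5)) ≤ Real.exp (-(1 * d * Real.log n)) := by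
      rw [Real.exp_le_exp]
      nlinarith
    linarith [measureReal_union_le (μ := P) bad₀ (⋃ S ∈ Finset.univ.powersetCard (d + 1), bad S)]
  -- The measurable hull has the same mass as `B`, so measurability of `B` need not be checked.
  refine ⟨(toMeasurable P B)ᶜ, (measurableSet_toMeasurable P B).compl, ?_, fun ω hω m hm => ?_⟩
  · rw [probReal_compl_eq_one_sub (measurableSet_toMeasurable P B), Measure.real,
      measure_toMeasurable]
    exact sub_le_sub_left hB 1
  · have hωB : ω ∉ B := fun h => hω (subset_toMeasurable P B h)
    simp only [B, bad₀, bad, Set.mem_union, Set.mem_ofPred_eq, Set.mem_iUnion,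
      Finset.mem_powersetCard, not_or, not_exists, not_and, not_le] at hωB
    have hmR : ‖m‖ ≤ R := norm_le_of_isShorth hn hkn hdk hr hωB.1.le
      (fun S hS => hωB.2 S ⟨Finset.subset_univ S, hS⟩) hm
    refine (ENNReal.ofReal_le_ofReal hmR).trans_eq ?_
    rw [hR, ENNReal.ofReal_mul (by positivity), ENNReal.ofReal_mul zero_le_four,
      ENNReal.ofReal_toReal htop]
    norm_num
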